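/- **Theorem (state observer convergence).** *Network.* Let $\mathcal G=(\mathcal V,\mathcal E)$ be a finite connected undirected simple graph, $k\in\mathbb N$ and $N\ge 1$. Let $\mathcal N_i$ be the set of neighbours of $i$ and $\mathcal N_i^{k}=\{l\in\mathcal V: 2\le \mathrm{dist}(i,l)\le k\}$ its $k$-hop neighbours, with $\eta_i=|\mathcal N_i^{k}|$. The agents obey $$\dot x_i=f(x_i)+Ax_i+u_i,\qquad x_i,u_i\in\mathbb R^N,\quad A\in\mathbb R^{N\times N},$$ where $f:\mathbb R^N\to\mathbb R^N$ is globally Lipschitz with constant $l_f$. Write $\mathbf x,\mathbf u$ for the vectors stacking all $x_i$, $u_i$. *Observer.* Let $\mathbf P_i$ and $\hat{\mathbf P}_i$ be the selection matrices extracting from $\mathbf x$ the blocks of the agents in $\mathcal N_i$ and in $\mathcal N_i^{k}$. Let $G\in\mathbb R^{N\times N}$ be symmetric positive definite and $\omega_j,\theta_j$ ($j\in\mathcal V$) real gains. Each agent $i$ holds an estimate $\hat{\mathbf x}^i=(\hat x^i_l)_{l\in\mathcal N_i^{k}}$ of the states of its $k$-hop neighbours and updates it by $$\dot{\hat{\mathbf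 x}}^i=\mathbf f(\hat{\mathbf x}^i)+(I_{\eta_i}\otimes A)\hat{\mathbf x}^i+(\Omega^i\otimes I_N)(I_{\eta_i}\otimes G)\boldsymbol\xi^i+(\Theta^i\otimes I_N)\,\mathrm{sign}\big((I_{\eta_i}\otimes G)\boldsymbol\xi^i\big)+\hat{\mathbf u}^i,$$ $$\boldsymbol\xi^i=\sum_{j\in\mathcal N_i}\Big[\hat{\mathbf P}_i\big(-\hat{\mathbf P}_j^\top\hat{\mathbf P}_j\hat{\mathbf P}_i^\top\hat{\mathbf x}^i+\hat{\mathbf P}_i^\top\hat{\mathbf P}_i\hat{\mathbf P}_j^\top\hat{\mathbf x}^j\big)+\hat{\mathbf P}_i\big(-\mathbf P_j^\top\mathbf P_j\hat{\mathbf P}_i^\top\hat{\mathbf x}^i+\hat{\mathbf P}_i^\top\hat{\mathbf P}_i\mathbf P_j^\top\mathbf P_j\mathbf x\big)\Big].$$ Here $\mathbf f$ applies $f$ blockwise, $\Omega^i=\mathrm{diag}(\omega_l)_{l\in\mathcal N_i^{k}}$, $\Theta^i=\mathrm{diag}(\theta_l)_{l\in\mathcal N_i^{k}}$, $\mathrm{sign}$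 acts componentwise with $\mathrm{sign}(r)=1$ for $r\ge0$ and $-1$ for $r<0$, and $\hat{\mathbf u}^i=(\hat u^i_l)_{l\in\mathcal N_i^{k}}$ is an estimate of the inputs. The inputs $u_j$ and the input estimates $\hat{\mathbf u}^j$ are measurable, locally bounded functions of time and possibly of the network state $(\mathbf x,(\hat{\mathbf x}^j)_j)$. Put $$\tilde{\mathbf x}_i=(x_i-\hat x^l_i)_{l\in\mathcal N_i^{k}},\qquad \tilde{\mathbf u}_i=(u_i-\hat u^l_i)_{l\in\mathcal N_i^{k}}.$$ *Solutions.* For measurable, locally bounded $g$ let $K[g](y)=\bigcap_{\delta>0}\bigcap_{\mu(M)=0}\overline{\mathrm{co}}\,g(B(y,\delta)\setminus M)$, with $\mu$ Lebesgue measure. A solution is a function $t\mapsto Y(t)=(\mathbf x(t),(\hat{\mathbf x}^j(t))_j)$ on $[0,\infty)$, absolutely continuous on compact intervals, with $\dot Y(t)\in K[F](t,Y(t))$ for almost every $t>0$, where $F$ is the right-hand side of the whole network as a function of (time, network state). For a solution, let $\|K[\tilde{\mathbf u}_i]\|$ be the supremum of $\|z\|$ over $z\in K[\tilde{\mathbf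 u}_i](t,Y(t))$, $t>0$. (If the inputs depend on time only this is the supremum over all $z\in K[\tilde{\mathbf u}_i](t)$, $t>0$.) *Matrices.* Let $M_i^{kc}=L_i+H_i$, where $L_i$ is the Laplacian of the subgraph induced on $\mathcal N_i^{k}$ and $H_i=\mathrm{diag}(|\mathcal N_l\cap\mathcal N_i|)_{l\in\mathcal N_i^{k}}$. $\|\cdot\|$ is the Euclidean norm of vectors and the spectral norm of matrices, and $\lambda_{\min},\lambda_{\max}$ are extreme eigenvalues. *Claim.* Let $Y$ be a solution and $i\in\mathcal V$ with $\mathcal N_i^{k}\ne\emptyset$. Suppose that $\|K[\tilde{\mathbf u}_i]\|\le d_{\tilde{\mathbf u}_i}<\infty$ and that $$\theta_i>\frac{\lambda_{\max}(M_i^{kc})\lambda_{\max}(G)}{\lambda_{\min}(M_i^{kc})\lambda_{\min}(G)}\,d_{\tilde{\mathbf u}_i},\qquad \omega_i\ge\frac1{\lambda_{\min}(M_i^{kc})}\Big(1+\frac{l_f\|M_i^{kc}\otimes G\|}{\lambda_{\min}(M_i^{kc})\lambda_{\min}(G^\top G)}\Big),\qquad G^\top A+A^\top G-2G^\top G\prec0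 .$$ Then $$\phi_i:=\theta_i\lambda_{\min}(M_i^{kc})\lambda_{\min}(G)-\|M_i^{kc}\otimes G\|\,\|K[\tilde{\mathbf u}_i]\|>0,$$ and there is a finite time $T_{x,i}\ge0$, with $T_{x,i}>0$ if $\tilde{\mathbf x}_i(0)\neq0$, such that $\tilde{\mathbf x}_i(t)=0$ for all $t\ge T_{x,i}$ and $$T_{x,i}\le\frac{\lambda_{\max}(M_i^{kc})\lambda_{\max}(G)}{\phi_i}\,\|\tilde{\mathbf x}_i(0)\|.$$ -/

import Mathlib

open MeasureTheory Set Topology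
open scoped NNReal ENNReal Matrix Kronecker

noncomputable section

/-! ### Filippov set-valued maps -/

/-- The Filippov set-valued map
`K[g](y) = ⋂_{δ > 0} ⋂_{μ(M) = 0} closure (co (g (B(y, δ) \ M)))`,
where `μ` is Lebesgue measure. -/
def filippovMap {E F : Type*} [PseudoMetricSpace E] [MeasureSpace E]
    [AddCommGroup F] [Module ℝ F] [TopologicalSpace F] (g : E → F) (y : E) : Set F :=
  ⋂ (δ : ℝ) (_ : 0 < δ) (M : Set E) (_ : volume M = 0),
    closure (convexHull ℝ (g '' (Metric.ball y δ \ M)))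

/-- `‖K[g]‖ = sup {‖z‖ : z ∈ K[g](y), y ∈ D}`, as an extended nonnegative real. -/
def filippovNorm {E F : Type*} [PseudoMetricSpace E] [MeasureSpace E]
    [NormedAddCommGroup F] [NormedSpace ℝ F] (g : E → F) (D : Set E) : ℝ≥0∞ :=
  ⨆ y ∈ D, ⨆ z ∈ filippovMap g y, ‖z‖ₑ

/-- Every point has a neighbourhood on which `g` is bounded. -/
def IsLocallyBounded {E F : Type*} [TopologicalSpace E] [Bornology F] (g : E → F) : Prop :=
  ∀ p, ∃ U ∈ 𝓝 p, Bornology.IsBounded (g '' U)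

/-- `y` is a (forward, global) Filippov solution of `ẏ = F(t, y)` with a possibly discontinuous
right-hand side: `y` is absolutely continuous on every `[0, T]`, and `ẏ(t) ∈ K[F](t, y(t))` for
almost every `t > 0`. The set-valued map is formed in the joint variable `(t, y)`, so that
discontinuities of the input signals in time are regularised too. -/
def IsFilippovSolution {E : Type*} [NormedAddCommGroup E] [NormedSpace ℝ E] [MeasureSpace E]
    (F : ℝ × E → E) (y : ℝ → E) : Prop :=
  (∀ T : ℝ, 0 ≤ T → AbsolutelyContinuousOnInterval y 0 T) ∧
    ∀ᵐ t : ℝ, 0 < t → ∃ v ∈ filippovMap F (t, y t), HasDerivAt y v t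

/-! ### Matrices -/

/-- Smallest eigenvalue of a (symmetric) real matrix. -/
def lamMin {m : Type*} [Fintype m] [DecidableEq m] (B : Matrix m m ℝ) : ℝ :=
  sInf (spectrum ℝ B)

/-- Largest eigenvalue of a (symmetric) real matrix. -/
def lamMax {m : Type*} [Fintype m] [DecidableEq m] (B : Matrix m m ℝ) : ℝ :=
  sSup (spectrum ℝ B)

/-- Spectral norm: the operator norm of `B` for the Euclidean vector norm. -/
def specNorm {m : Type*} [Fintype m] [DecidableEq m] (B : Matrix m m ℝ) : ℝ :=
  ‖Matrix.toEuclideanCLM (n := m) (𝕜 := ℝ) B‖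

/-- The discontinuous sign function, with value `1` at `0`. -/
def sgn (r : ℝ) : ℝ := if 0 ≤ r then 1 else -1

/-! ### The network and its `k`-hop neighbourhoods -/

section Network

variable {V : Type*} [Fintype V] [DecidableEq V] (𝒢 : SimpleGraph V) [DecidableRel 𝒢.Adj]
  (k N : ℕ)

/-- The `k`-hop neighbours of agent `i`: the agents at graph distance at least `2` and
at most `k` from `i` (agent `i` itself and its `1`-hop neighbours are excluded). -/
def kHop (i : V) : Set V := {l | 2 ≤ 𝒢.dist i l ∧ 𝒢.dist i l ≤ k}

instance (i : V) : DecidablePred (· ∈ kHop 𝒢 k i) := fun l =>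
  inferInstanceAs (Decidable (2 ≤ 𝒢.dist i l ∧ 𝒢.dist i l ≤ k))

/-- If `l` is a `k`-hop neighbour of `i`, then `i` is one of `l`. -/
def kHopSwap {i : V} (l : kHop 𝒢 k i) : kHop 𝒢 k l.1 :=
  ⟨i, by
    have h : 2 ≤ 𝒢.dist i l ∧ 𝒢.dist i l ≤ k := l.2
    rw [SimpleGraph.dist_comm] at h
    exact h⟩

/-- `ℝ^{|ι| N}`: stacks of vectors of `ℝ^N` indexed by `ι`, with the Euclidean norm. -/
abbrev Stack (ι : Type*) := EuclideanSpace ℝ (ι × Fin N)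

/-- State of the whole network: the stacked agents' states `x`, and for each agent `i` its stacked
estimate `x̂^i` of the states of its `k`-hop neighbours. Pairs (stacked inputs `u`, input estimates
`û^i`) have the same format. -/
abbrev NetState := Stack N V × ((i : V) → Stack N (kHop 𝒢 k i))

/-- The `a`-th block of a stacked vector. -/
def block {N : ℕ} {ι : Type*} (z : Stack N ι) (a : ι) : EuclideanSpace ℝ (Fin N) :=
  WithLp.toLp 2 fun c => z (a, c)

/-- The map applying `f` to each block of a stacked vector. -/
def stackMap {N : ℕ} {ι : Type*} (f : EuclideanSpace ℝ (Fin N) → EuclideanSpace ℝ (Fin N))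
    (z : Stack N ι) : Stack N ι :=
  WithLp.toLp 2 fun r => f (block z r.1) r.2

/-- The selection matrix extracting from a stack over all agents the blocks indexed by `s`. -/
def selMatrix (s : Set V) : Matrix (s × Fin N) (V × Fin N) ℝ :=
  Matrix.of fun r c => if (r.1.1, r.2) = c then 1 else 0

/-- `P_i`: selects the states of the `1`-hop neighbours of `i`. -/
def selNbr (i : V) : Matrix (𝒢.neighborSet i × Fin N) (V × Fin N) ℝ :=
  selMatrix N (𝒢.neighborSet i)

/-- `P̂_i`: selects the states of the `k`-hop neighbours of `i`. -/
def selHop (i : V) : Matrix (kHop 𝒢 k i × Fin N) (V × Fin N) ℝ :=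
  selMatrix N (kHop 𝒢 k i)

/-- The innovation term `ξ^i` of agent `i`, which uses only data from its `1`-hop neighbours `j`:
their estimates `x̂^j` and the states of their own `1`-hop neighbours. -/
def innovation (Y : NetState 𝒢 k N) (i : V) : kHop 𝒢 k i × Fin N → ℝ :=
  let P := selNbr 𝒢 N
  let Q := selHop 𝒢 k N
  ∑ j ∈ 𝒢.neighborFinset i,
    (Q i *ᵥ (-(((Q j)ᵀ * Q j * (Q i)ᵀ) *ᵥ (Y.2 i).ofLp)
        + ((Q i)ᵀ * Q i * (Q j)ᵀ) *ᵥ (Y.2 j).ofLp)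
      + Q i *ᵥ (-(((P j)ᵀ * P j * (Q i)ᵀ) *ᵥ (Y.2 i).ofLp)
        + ((Q i)ᵀ * Q i * (P j)ᵀ * P j) *ᵥ Y.1.ofLp))

/-- Right-hand side of the observer run by agent `i`:
`f(x̂^i) + (I ⊗ A) x̂^i + (Ω^i ⊗ I)(I ⊗ G) ξ^i + (Θ^i ⊗ I) sign((I ⊗ G) ξ^i) + û^i`,
with `Ω^i = diag(ω_l)` and `Θ^i = diag(θ_l)`, `l` running over the `k`-hop neighbours of `i`. -/
def observerField (f : EuclideanSpace ℝ (Fin N) → EuclideanSpace ℝ (Fin N))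
    (A G : Matrix (Fin N) (Fin N) ℝ) (ω θ : V → ℝ) (Y : NetState 𝒢 k N) (i : V)
    (uhat : Stack N (kHop 𝒢 k i)) : Stack N (kHop 𝒢 k i) :=
  let I := (1 : Matrix (kHop 𝒢 k i) (kHop 𝒢 k i) ℝ)
  let Ω := Matrix.diagonal fun l : kHop 𝒢 k i => ω l
  let Θ := Matrix.diagonal fun l : kHop 𝒢 k i => θ l
  let Gξ := (I ⊗ₖ G) *ᵥ innovation 𝒢 k N Y i
  stackMap f (Y.2 i)
    + WithLp.toLp 2 ((I ⊗ₖ A) *ᵥ (Y.2 i).ofLp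
        + (Ω ⊗ₖ (1 : Matrix (Fin N) (Fin N) ℝ)) *ᵥ Gξ
        + (Θ ⊗ₖ (1 : Matrix (Fin N) (Fin N) ℝ)) *ᵥ (fun r => sgn (Gξ r)))
    + uhat

/-- Right-hand side of the stacked agents' dynamics `ẋ_i = f(x_i) + A x_i + u_i`. -/
def agentField (f : EuclideanSpace ℝ (Fin N) → EuclideanSpace ℝ (Fin N))
    (A : Matrix (Fin N) (Fin N) ℝ) (x u : Stack N V) : Stack N V :=
  stackMap f x + WithLp.toLp 2 (((1 : Matrix V V ℝ) ⊗ₖ A) *ᵥ x.ofLp) + u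

/-- The vector field of the whole network: agents and observers, with inputs `u` and
input estimates `û^i` that may depend on time and on the state of the network. -/
def networkField (f : EuclideanSpace ℝ (Fin N) → EuclideanSpace ℝ (Fin N))
    (A G : Matrix (Fin N) (Fin N) ℝ) (ω θ : V → ℝ)
    (u : ℝ × NetState 𝒢 k N → Stack N V)
    (uhat : ℝ × NetState 𝒢 k N → (i : V) → Stack N (kHop 𝒢 k i))
    (p : ℝ × NetState 𝒢 k N) : NetState 𝒢 k N :=
  (agentField N f A p.2.1 (u p),
    fun i => observerField 𝒢 k N f A G ω θ p.2 i (uhat p i))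

/-- The stacked error on agent `i`: its `l`-th block, for `l` a `k`-hop neighbour of `i`, is
`z_i - ẑ^l_i`, where `ẑ^l_i` is the estimate of `z_i` held by agent `l`. Applied to states this
is `x̃_i`, applied to inputs it is `ũ_i`. -/
def estError (i : V) (Z : NetState 𝒢 k N) : Stack N (kHop 𝒢 k i) :=
  WithLp.toLp 2 fun r => Z.1 (i, r.2) - Z.2 r.1.1 (kHopSwap 𝒢 k r.1, r.2)

/-- `M_i = L_i + H_i`, with `L_i` the Laplacian of the subgraph induced by the `k`-hop neighbours
of `i`, and `H_i` the diagonal matrix counting common `1`-hop neighbours with `i`. -/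
def Mkc (i : V) : Matrix (kHop 𝒢 k i) (kHop 𝒢 k i) ℝ :=
  (𝒢.induce (kHop 𝒢 k i)).lapMatrix ℝ
    + Matrix.diagonal fun l : kHop 𝒢 k i =>
        ((𝒢.neighborFinset l.1 ∩ 𝒢.neighborFinset i).card : ℝ)

/-- `φ_i = θ_i λ_min(M_i) λ_min(G) - ‖M_i ⊗ G‖ ‖K[ũ_i]‖`, the argument `κ` being `‖K[ũ_i]‖`. -/
def phi (G : Matrix (Fin N) (Fin N) ℝ) (θ : V → ℝ) (i : V) (κ : ℝ) : ℝ :=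
  θ i * lamMin (Mkc 𝒢 k i) * lamMin G - specNorm (Mkc 𝒢 k i ⊗ₖ G) * κ

end Network

end

/-! Collect in `e = estError 𝒢 k N i (Y t)` the errors of all agents that estimate agent `i`. Every
agent `l` sees only its neighbours, but the `i`-blocks of the innovations of all these `l` assemble
to `w = (M ⊗ G) e` with `M = Mkc 𝒢 k i` (`kronecker_innovation_kHopSwap`). Hence only the gains with
index `i` enter, and off the discontinuities `ė = Δf + (I ⊗ A) e - ω_i w - θ_i sgn w + ũ_i`
(`estError_networkField_apply`), where `Δf` is `driftError`. Connectedness makes `M` positive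
definite (`posDef_Mkc`).

The Lyapunov function is `W = e · (M ⊗ G) e`, with `W' = 2 w · ė`. The condition on `ω_i` lets `-ω_i
|w|²` absorb the terms in `f` and `A` (`dotProduct_continuous_part_nonpos`). The sign term gives
`-θ_i |w|₁`, which beats the disturbance and leaves `-φ |e|` (`sign_part_le`). Since `W ≤ Λ |e|²`
with `Λ = λ_max(M) λ_max(G)`, this reads `W' ≤ -2 (φ/√Λ) √W`, so `W` vanishes after time `√Λ √(W 0)
/ φ ≤ (Λ/φ) |e 0|` (`eq_zero_of_ae_deriv_le_neg_sqrt`).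

For a Filippov velocity `v` at `p`, no calculus of set-valued maps is needed: the weight `w p` is
frozen, and the linear functional `w p · _` is bounded on the field near `p` off a null set, a bound
inherited by closed convex hulls (`le_of_mem_filippovMap`). The bound on `K[ũ_i]` is transferred to
nearby values of `ũ_i` by compactness (`exists_ball_diff_null_lt_of_filippovMap`). -/

/-! ### Linear functionals on Filippov set-valued maps -/

/-- A bound on a linear functional that holds for `g` near `p`, off a null set, passes to every
element of the Filippov set at `p`. -/
theorem le_of_mem_filippovMap {E F : Type*} [PseudoMetricSpace E] [MeasureSpace E]
    [AddCommGroup F] [Module ℝ F] [TopologicalSpace F] {g : E → F} {p : E} {v : F}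
    (hv : v ∈ filippovMap g p) (φ : F →L[ℝ] ℝ) {c δ : ℝ} (hδ : 0 < δ) {M : Set E}
    (hM : volume M = 0) (h : ∀ q ∈ Metric.ball p δ \ M, φ (g q) ≤ c) : φ v ≤ c := by
  have hv' : v ∈ closure (convexHull ℝ (g '' (Metric.ball p δ \ M))) := by
    simp only [filippovMap, mem_iInter] at hv
    exact hv δ hδ M hM
  have hcl : IsClosed {z : F | φ z ≤ c} := isClosed_le φ.continuous continuous_const
  have hco : Convex ℝ {z : F | φ z ≤ c} := convex_halfSpace_le φ.toLinearMap.isLinear c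
  have hsub : g '' (Metric.ball p δ \ M) ⊆ {z : F | φ z ≤ c} := by
    rintro _ ⟨q, hq, rfl⟩
    exact h q hq
  exact closure_minimal (convexHull_min hsub hco) hcl hv'

/-- A strict bound on a linear functional over the Filippov set of a locally bounded function at
`p` holds for the function itself near `p`, off a null set. -/
theorem exists_ball_diff_null_lt_of_filippovMap {E F : Type*} [PseudoMetricSpace E]
    [MeasureSpace E] [NormedAddCommGroup F] [NormedSpace ℝ F] [ProperSpace F] {g : E → F} {p : E}
    (hg : ∃ U ∈ 𝓝 p, Bornology.IsBounded (g '' U)) (φ : F →L[ℝ] ℝ) {c : ℝ}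
    (h : ∀ z ∈ filippovMap g p, φ z < c) :
    ∃ δ > 0, ∃ M : Set E, volume M = 0 ∧ ∀ q ∈ Metric.ball p δ \ M, φ (g q) < c := by
  by_contra! hcon
  obtain ⟨U, hU, hbd⟩ := hg
  obtain ⟨ρ, hρ, hρU⟩ := Metric.mem_nhds_iff.1 hU
  -- Radii are capped at `ρ` so that the closed hulls are bounded, hence compact. If the claim
  -- fails, each hull meets the half-space `c ≤ φ`; the family is directed, so the intersections
  -- share a point, which lies in the Filippov set and contradicts `h`.
  let ι := {x : ℝ × Set E // 0 < x.1 ∧ x.1 ≤ ρ ∧ volume x.2 = 0}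
  let C : ι → Set F := fun x =>
    closure (convexHull ℝ (g '' (Metric.ball p x.1.1 \ x.1.2))) ∩ {z | c ≤ φ z}
  have hcl : ∀ x, IsClosed (C x) := fun x =>
    isClosed_closure.inter (isClosed_le continuous_const φ.continuous)
  have hcpt : ∀ x, IsCompact (C x) := by
    intro x
    refine Metric.isCompact_of_isClosed_isBounded (hcl x) ?_
    refine Bornology.IsBounded.subset ?_ inter_subset_left
    refine ((isBounded_convexHull (E := F)).2 (hbd.subset ?_)).closure
    exact image_mono ((sdiff_subset.trans (Metric.ball_subset_ball x.2.2.1)).trans hρU)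
  have hne : ∀ x, (C x).Nonempty := by
    intro x
    obtain ⟨q, hq, hcq⟩ := hcon x.1.1 x.2.1 x.1.2 x.2.2.2
    exact ⟨g q, subset_closure (subset_convexHull ℝ _ (mem_image_of_mem g hq)), hcq⟩
  have hdir : Directed (· ⊇ ·) C := by
    intro x y
    refine ⟨⟨(min x.1.1 y.1.1, x.1.2 ∪ y.1.2), lt_min x.2.1 y.2.1,
      (min_le_left _ _).trans x.2.2.1, measure_union_null x.2.2.2 y.2.2.2⟩, ?_, ?_⟩
    · refine inter_subset_inter_left _ (closure_mono (convexHull_mono (image_mono ?_)))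
      exact sdiff_subset_sdiff (Metric.ball_subset_ball (min_le_left _ _)) subset_union_left
    · refine inter_subset_inter_left _ (closure_mono (convexHull_mono (image_mono ?_)))
      exact sdiff_subset_sdiff (Metric.ball_subset_ball (min_le_right _ _)) subset_union_right
  have : Nonempty ι := ⟨⟨(ρ, ∅), hρ, le_rfl, measure_empty⟩⟩
  obtain ⟨z, hz⟩ :=
    IsCompact.nonempty_iInter_of_directed_nonempty_isCompact_isClosed C hdir hne hcpt hcl
  rw [mem_iInter] at hz
  refine (h z ?_).not_ge (hz ⟨(ρ, ∅), hρ, le_rfl, measure_empty⟩).2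
  simp only [filippovMap, mem_iInter]
  intro δ hδ M hM
  have h1 := (hz ⟨(min δ ρ, M), lt_min hδ hρ, min_le_right _ _, hM⟩).1
  refine closure_mono (convexHull_mono (image_mono ?_)) h1
  exact sdiff_subset_sdiff_left (Metric.ball_subset_ball (min_le_left _ _))

/-- Every element of the Filippov set at a point of `D` is bounded by the Filippov norm. -/
theorem norm_le_toReal_filippovNorm {E F : Type*} [PseudoMetricSpace E] [MeasureSpace E]
    [NormedAddCommGroup F] [NormedSpace ℝ F] {g : E → F} {D : Set E}
    (hfin : filippovNorm g D ≠ ∞) {y : E} (hy : y ∈ D) {z : F} (hz : z ∈ filippovMap g y) :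
    ‖z‖ ≤ (filippovNorm g D).toReal := by
  have h : ‖z‖ₑ ≤ filippovNorm g D :=
    (le_iSup₂ (f := fun z (_ : z ∈ filippovMap g y) => ‖z‖ₑ) z hz).trans
      (le_iSup₂ (f := fun y (_ : y ∈ D) => ⨆ z ∈ filippovMap g y, ‖z‖ₑ) y hy)
  simpa using ENNReal.toReal_mono hfin h

/-! ### Absolutely continuous functions -/

/-- Postcomposition with a function that is Lipschitz on the image preserves absolute
continuity. -/
theorem LipschitzOnWith.comp_absolutelyContinuousOnInterval {X Y : Type*} [PseudoMetricSpace X]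
    [PseudoMetricSpace Y] {K : ℝ≥0} {φ : X → Y} {s : Set X} (hφ : LipschitzOnWith K φ s)
    {y : ℝ → X} {a b : ℝ} (hy : AbsolutelyContinuousOnInterval y a b)
    (hs : ∀ t ∈ uIcc a b, y t ∈ s) : AbsolutelyContinuousOnInterval (fun t => φ (y t)) a b := by
  rw [absolutelyContinuousOnInterval_iff] at hy ⊢
  intro ε hε
  -- `K + 1` instead of `K` keeps the quotient meaningful when `K = 0`.
  obtain ⟨δ, hδ, h⟩ := hy (ε / (K + 1)) (by positivity)
  refine ⟨δ, hδ, fun E hE hlt => ?_⟩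
  have h1 := h E hE hlt
  rw [lt_div_iff₀ (by positivity)] at h1
  refine lt_of_le_of_lt ?_ h1
  rw [Finset.sum_mul]
  refine Finset.sum_le_sum fun j hj => ?_
  have h2 := hφ.dist_le_mul _ (hs _ (hE.1 j hj).1) _ (hs _ (hE.1 j hj).2)
  nlinarith [dist_nonneg (x := y (E.2 j).1) (y := y (E.2 j).2)]

/-- An absolutely continuous function whose derivative is a.e. at most `c` grows at rate at most
`c`. -/
theorem AbsolutelyContinuousOnInterval.sub_le_mul_of_ae_deriv_le {v : ℝ → ℝ} {a b c : ℝ}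
    (hab : a ≤ b) (hv : AbsolutelyContinuousOnInterval v a b)
    (h : ∀ᵐ t, t ∈ Ioc a b → deriv v t ≤ c) : v b - v a ≤ c * (b - a) := by
  rw [← hv.integral_deriv_eq_sub]
  have h1 : ∫ t in a..b, deriv v t ≤ ∫ _t in a..b, c := by
    refine intervalIntegral.integral_mono_ae_restrict hab hv.intervalIntegrable_deriv
      intervalIntegrable_const ?_
    have h2 : ∀ᵐ t, t ∈ Icc a b → deriv v t ≤ c := by
      filter_upwards [h, measure_eq_zero_iff_ae_notMem.1 (measure_singleton (μ := volume) a)]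
        with t ht hta hmem
      exact ht ⟨lt_of_le_of_ne hmem.1 fun h => hta h.symm, hmem.2⟩
    exact (ae_restrict_iff' measurableSet_Icc).2 h2
  simpa [mul_comm] using h1

/-- Finite-time stability: a nonnegative absolutely continuous function with
`V' ≤ -2 c √V` almost everywhere vanishes from time `√(V 0) / c` on. -/
theorem eq_zero_of_ae_deriv_le_neg_sqrt {V : ℝ → ℝ} {c t : ℝ} (hc : 0 < c) (hV : ∀ s, 0 ≤ V s)
    (hac : AbsolutelyContinuousOnInterval V 0 t)
    (hd : ∀ᵐ s, 0 < s → ∃ v, HasDerivAt V v s ∧ v ≤ -(2 * c * √(V s)))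
    (ht : √(V 0) / c ≤ t) : V t = 0 := by
  by_contra hne
  have ht0 : 0 ≤ t := (by positivity : 0 ≤ √(V 0) / c).trans ht
  have hpos : 0 < V t := lt_of_le_of_ne (hV t) (Ne.symm hne)
  -- `V` is nonincreasing, so if `V t > 0` it stays at or above `V t` on `[0, t]`. There the square
  -- root is Lipschitz, and `√V` is absolutely continuous.
  have hlow : ∀ s ∈ uIcc 0 t, V s ∈ Ici (V t) := by
    intro s hs
    rw [uIcc_of_le ht0] at hs
    have hac' : AbsolutelyContinuousOnInterval V s t :=
      hac.mono (by rw [uIcc_of_le hs.2, uIcc_of_le ht0]; exact Icc_subset_Icc_left hs.1)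
    have := hac'.sub_le_mul_of_ae_deriv_le (c := 0) hs.2 (by
      filter_upwards [hd] with r hr hmem
      obtain ⟨v, hv, hle⟩ := hr (hs.1.trans_lt hmem.1)
      rw [hv.deriv]
      exact hle.trans (neg_nonpos.2 (by positivity)))
    simp only [mem_Ici]
    linarith
  have hlip : LipschitzOnWith (Real.toNNReal (1 / √(V t))) Real.sqrt (Ici (V t)) := by
    refine LipschitzOnWith.of_dist_le_mul fun x hx y hy => ?_
    have hs : 0 < √(V t) := Real.sqrt_pos.2 hpos
    have hx' : √(V t) ≤ √x := Real.sqrt_le_sqrt hx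
    have hx0 : 0 ≤ x := hpos.le.trans hx
    have hy0 : 0 ≤ y := hpos.le.trans hy
    rw [Real.coe_toNNReal _ (by positivity), one_div, ← div_eq_inv_mul, le_div_iff₀ hs,
      Real.dist_eq, Real.dist_eq]
    have hxy : x - y = (√x - √y) * (√x + √y) := by
      nlinarith [Real.mul_self_sqrt hx0, Real.mul_self_sqrt hy0]
    rw [hxy, abs_mul, abs_of_nonneg (a := √x + √y) (by positivity)]
    exact mul_le_mul_of_nonneg_left (by linarith [Real.sqrt_nonneg y]) (abs_nonneg _)
  have hacs := hlip.comp_absolutelyContinuousOnInterval hac hlow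
  -- `(√V)' = V' / (2√V) ≤ -c`, hence `√(V t) ≤ √(V 0) - c t ≤ 0`, a contradiction.
  have h1 := hacs.sub_le_mul_of_ae_deriv_le (c := -c) ht0 (by
    filter_upwards [hd] with s hs hmem
    obtain ⟨v, hv, hle⟩ := hs hmem.1
    have hVs : 0 < V s :=
      hpos.trans_le (hlow s (by rw [uIcc_of_le ht0]; exact Ioc_subset_Icc_self hmem))
    rw [(hv.sqrt hVs.ne').deriv, div_le_iff₀ (by positivity)]
    linarith)
  rw [div_le_iff₀ hc] at ht
  have : 0 < √(V t) := Real.sqrt_pos.2 hpos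
  linarith

/-! ### Spectral bounds for symmetric matrices -/

section Spectral

theorem Matrix.PosDef.transpose_eq {m : Type*} {S : Matrix m m ℝ} (hS : S.PosDef) : Sᵀ = S := by
  simpa [Matrix.conjTranspose_eq_transpose_of_trivial] using hS.1.eq

theorem Matrix.PosSemidef.dotProduct_mulVec_self_nonneg {m : Type*} [Fintype m]
    {S : Matrix m m ℝ} (hS : S.PosSemidef) (x : m → ℝ) : 0 ≤ x ⬝ᵥ S *ᵥ x := by
  simpa using hS.dotProduct_mulVec_nonneg x

theorem dotProduct_mulVec_smul_one_kronecker {m n : Type*} [Fintype m]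
    [DecidableEq m] [Fintype n] (a : ℝ) (R : Matrix n n ℝ) (x : m × n → ℝ) :
    x ⬝ᵥ ((a • (1 : Matrix m m ℝ)) ⊗ₖ R) *ᵥ x = a * (x ⬝ᵥ ((1 : Matrix m m ℝ) ⊗ₖ R) *ᵥ x) := by
  rw [Matrix.smul_kronecker, Matrix.smul_mulVec, dotProduct_smul, smul_eq_mul]

theorem Matrix.PosDef.mulVec_dotProduct_comm {m : Type*} [Fintype m] {S : Matrix m m ℝ}
    (hS : S.PosDef) (x y : m → ℝ) :
    (S *ᵥ x) ⬝ᵥ y = x ⬝ᵥ S *ᵥ y := by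
  rw [Matrix.dotProduct_mulVec, ← Matrix.mulVec_transpose, hS.transpose_eq]

/-- `|(S ⊗ R) x|² = x · (S² ⊗ R²) x`. -/
theorem mulVec_kronecker_dotProduct_self {m n : Type*} [Fintype m] [Fintype n]
    {S : Matrix m m ℝ} {R : Matrix n n ℝ}
    (hS : S.PosDef) (hR : R.PosDef) (x : m × n → ℝ) :
    ((S ⊗ₖ R) *ᵥ x) ⬝ᵥ ((S ⊗ₖ R) *ᵥ x) = x ⬝ᵥ ((S * S) ⊗ₖ (R * R)) *ᵥ x := by
  rw [(hS.kronecker hR).mulVec_dotProduct_comm, Matrix.mulVec_mulVec, Matrix.mul_kronecker_mul]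

theorem dotProduct_mulVec_kronecker_mono_left {m n : Type*} [Fintype m] [Fintype n]
    {S S' : Matrix m m ℝ} {R : Matrix n n ℝ}
    (hS : (S' - S).PosSemidef) (hR : R.PosSemidef) (x : m × n → ℝ) :
    x ⬝ᵥ (S ⊗ₖ R) *ᵥ x ≤ x ⬝ᵥ (S' ⊗ₖ R) *ᵥ x := by
  have h := (hS.kronecker hR).dotProduct_mulVec_self_nonneg x
  have hsub : (S' - S) ⊗ₖ R = S' ⊗ₖ R - S ⊗ₖ R := by
    ext i j
    simp [sub_mul]
  rwa [hsub, Matrix.sub_mulVec, dotProduct_sub, sub_nonneg] at h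

theorem dotProduct_mulVec_kronecker_mono_right {m n : Type*} [Fintype m] [Fintype n]
    {S : Matrix m m ℝ} {R R' : Matrix n n ℝ}
    (hS : S.PosSemidef) (hR : (R' - R).PosSemidef) (x : m × n → ℝ) :
    x ⬝ᵥ (S ⊗ₖ R) *ᵥ x ≤ x ⬝ᵥ (S ⊗ₖ R') *ᵥ x := by
  have h := (hS.kronecker hR).dotProduct_mulVec_self_nonneg x
  have hsub : S ⊗ₖ (R' - R) = S ⊗ₖ R' - S ⊗ₖ R := by
    ext i j
    simp [mul_sub]
  rwa [hsub, Matrix.sub_mulVec, dotProduct_sub, sub_nonneg] at h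

variable {m n : Type*} [Fintype m] [DecidableEq m] [Fintype n] [DecidableEq n]

theorem Matrix.IsHermitian.lamMin_le_eigenvalues {S : Matrix m m ℝ} (hS : S.IsHermitian) (j : m) :
    lamMin S ≤ hS.eigenvalues j :=
  csInf_le S.finite_real_spectrum.bddBelow (hS.eigenvalues_mem_spectrum_real j)

theorem Matrix.IsHermitian.eigenvalues_le_lamMax {S : Matrix m m ℝ} (hS : S.IsHermitian) (j : m) :
    hS.eigenvalues j ≤ lamMax S :=
  le_csSup S.finite_real_spectrum.bddAbove (hS.eigenvalues_mem_spectrum_real j)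

/-- The `y j` are the coordinates of `x` in an orthonormal eigenbasis. -/
theorem Matrix.IsHermitian.exists_dotProduct_mulVec_eq {S : Matrix m m ℝ} (hS : S.IsHermitian)
    (x : m → ℝ) : ∃ y : m → ℝ, x ⬝ᵥ x = ∑ j, y j ^ 2 ∧
      x ⬝ᵥ S *ᵥ x = ∑ j, hS.eigenvalues j * y j ^ 2 := by
  let b := hS.eigenvectorBasis
  let X : EuclideanSpace ℝ m := WithLp.toLp 2 x
  have hin : ∀ Z : EuclideanSpace ℝ m, x ⬝ᵥ Z.ofLp = inner ℝ X Z := fun Z => by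
    simp [EuclideanSpace.inner_eq_star_dotProduct, X, dotProduct_comm]
  refine ⟨fun j => inner ℝ X (b j), ?_, ?_⟩
  · rw [show x ⬝ᵥ x = inner ℝ X X from hin X, ← b.sum_inner_mul_inner X X]
    refine Finset.sum_congr rfl fun j _ => ?_
    rw [real_inner_comm X (b j), sq]
  · have h1 : inner ℝ X (WithLp.toLp 2 (S *ᵥ x) : EuclideanSpace ℝ m) = x ⬝ᵥ S *ᵥ x := (hin _).symm
    rw [← h1, ← b.sum_inner_mul_inner]
    refine Finset.sum_congr rfl fun j _ => ?_
    have h2 : inner ℝ (b j) (WithLp.toLp 2 (S *ᵥ x) : EuclideanSpace ℝ m)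
        = hS.eigenvalues j * inner ℝ X (b j) := by
      rw [EuclideanSpace.inner_eq_star_dotProduct, star_trivial, dotProduct_comm,
        Matrix.dotProduct_mulVec, ← Matrix.mulVec_transpose,
        show Sᵀ = S by simpa [Matrix.conjTranspose_eq_transpose_of_trivial] using hS.eq,
        hS.mulVec_eigenvectorBasis j, smul_dotProduct, dotProduct_comm, hin, smul_eq_mul]
    rw [h2]
    ring

theorem Matrix.IsHermitian.posSemidef_sub_lamMin {S : Matrix m m ℝ} (hS : S.IsHermitian) :
    (S - lamMin S • (1 : Matrix m m ℝ)).PosSemidef := by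
  refine .of_dotProduct_mulVec_nonneg (hS.sub (by simp [Matrix.IsHermitian])) fun x => ?_
  obtain ⟨y, h1, h2⟩ := hS.exists_dotProduct_mulVec_eq x
  rw [star_trivial, Matrix.sub_mulVec, dotProduct_sub, Matrix.smul_mulVec, Matrix.one_mulVec,
    dotProduct_smul, h1, h2, smul_eq_mul, Finset.mul_sum, sub_nonneg]
  exact Finset.sum_le_sum fun j _ =>
    mul_le_mul_of_nonneg_right (hS.lamMin_le_eigenvalues j) (sq_nonneg _)

theorem Matrix.IsHermitian.posSemidef_lamMax_sub {S : Matrix m m ℝ} (hS : S.IsHermitian) :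
    (lamMax S • (1 : Matrix m m ℝ) - S).PosSemidef := by
  refine .of_dotProduct_mulVec_nonneg (Matrix.IsHermitian.sub (by simp [Matrix.IsHermitian]) hS)
    fun x => ?_
  obtain ⟨y, h1, h2⟩ := hS.exists_dotProduct_mulVec_eq x
  rw [star_trivial, Matrix.sub_mulVec, dotProduct_sub, Matrix.smul_mulVec, Matrix.one_mulVec,
    dotProduct_smul, h1, h2, smul_eq_mul, Finset.mul_sum, sub_nonneg]
  exact Finset.sum_le_sum fun j _ =>
    mul_le_mul_of_nonneg_right (hS.eigenvalues_le_lamMax j) (sq_nonneg _)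

/-- The spectrum is finite and nonempty, so its infimum is attained at an eigenvalue. For an empty
index type `lamMin` would be `sInf ∅ = 0`. -/
theorem Matrix.PosDef.lamMin_pos [Nonempty m] {S : Matrix m m ℝ} (hS : S.PosDef) :
    0 < lamMin S := by
  have hne : (spectrum ℝ S).Nonempty :=
    ⟨_, hS.1.eigenvalues_mem_spectrum_real (Classical.arbitrary m)⟩
  have hmem : lamMin S ∈ spectrum ℝ S := hne.csInf_mem S.finite_real_spectrum
  rw [hS.1.spectrum_real_eq_range_eigenvalues] at hmem
  obtain ⟨j, hj⟩ := hmem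
  exact hj ▸ hS.eigenvalues_pos j

theorem Matrix.PosDef.lamMax_pos [Nonempty m] {S : Matrix m m ℝ} (hS : S.PosDef) :
    0 < lamMax S :=
  (hS.eigenvalues_pos (Classical.arbitrary m)).trans_le (hS.1.eigenvalues_le_lamMax _)

theorem dotProduct_mulVec_one_kronecker_smul_one (a : ℝ) (x : m × n → ℝ) :
    x ⬝ᵥ ((1 : Matrix m m ℝ) ⊗ₖ (a • (1 : Matrix n n ℝ))) *ᵥ x = a * (x ⬝ᵥ x) := by
  rw [Matrix.kronecker_smul, Matrix.smul_mulVec, dotProduct_smul, smul_eq_mul,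
    Matrix.one_kronecker_one, Matrix.one_mulVec]

/-- `x · (S ⊗ R) x ≤ λ_max(S) λ_max(R) |x|²`. -/
theorem dotProduct_mulVec_kronecker_le [Nonempty m] {S : Matrix m m ℝ} {R : Matrix n n ℝ}
    (hS : S.PosDef) (hR : R.PosDef) (x : m × n → ℝ) :
    x ⬝ᵥ (S ⊗ₖ R) *ᵥ x ≤ lamMax S * lamMax R * (x ⬝ᵥ x) := by
  have h1 := dotProduct_mulVec_kronecker_mono_left hS.1.posSemidef_lamMax_sub hR.posSemidef x
  have h2 := dotProduct_mulVec_kronecker_mono_right (m := m) .one hR.1.posSemidef_lamMax_sub x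
  rw [dotProduct_mulVec_smul_one_kronecker] at h1
  rw [dotProduct_mulVec_one_kronecker_smul_one] at h2
  nlinarith [hS.lamMax_pos]

/-- `λ_min(S) λ_min(R) |x|² ≤ x · (S ⊗ R) x`. -/
theorem le_dotProduct_mulVec_kronecker [Nonempty m] {S : Matrix m m ℝ} {R : Matrix n n ℝ}
    (hS : S.PosDef) (hR : R.PosDef) (x : m × n → ℝ) :
    lamMin S * lamMin R * (x ⬝ᵥ x) ≤ x ⬝ᵥ (S ⊗ₖ R) *ᵥ x := by
  have h1 := dotProduct_mulVec_kronecker_mono_left hS.1.posSemidef_sub_lamMin hR.posSemidef x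
  have h2 := dotProduct_mulVec_kronecker_mono_right (m := m) .one hR.1.posSemidef_sub_lamMin x
  rw [dotProduct_mulVec_smul_one_kronecker] at h1
  rw [dotProduct_mulVec_one_kronecker_smul_one] at h2
  nlinarith [hS.lamMin_pos]

/-- With `λ = lamMin S`: `S² - λS = (S - λ)² + λ(S - λ)`. -/
theorem Matrix.PosDef.posSemidef_mul_self_sub {m : Type*} [Fintype m] [DecidableEq m]
    [Nonempty m] {S : Matrix m m ℝ} (hS : S.PosDef) :
    (S * S - lamMin S • S).PosSemidef := by
  have h := hS.1.posSemidef_sub_lamMin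
  have h1 := Matrix.posSemidef_conjTranspose_mul_self (S - lamMin S • (1 : Matrix m m ℝ))
  rw [h.1.eq] at h1
  have h2 := h1.add (h.smul hS.lamMin_pos.le)
  convert h2 using 1
  simp only [mul_sub, sub_mul, smul_sub, Matrix.smul_mul, Matrix.mul_smul, one_mul, mul_one]
  abel

/-- `λ_min(S) x · (S ⊗ R²) x ≤ |(S ⊗ R) x|²`. -/
theorem lamMin_mul_dotProduct_le_sq {m n : Type*} [Fintype m] [DecidableEq m] [Fintype n]
    [Nonempty m] {S : Matrix m m ℝ} {R : Matrix n n ℝ}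
    (hS : S.PosDef) (hR : R.PosDef) (x : m × n → ℝ) :
    lamMin S * (x ⬝ᵥ (S ⊗ₖ (R * R)) *ᵥ x) ≤ ((S ⊗ₖ R) *ᵥ x) ⬝ᵥ ((S ⊗ₖ R) *ᵥ x) := by
  have hRR : (R * R).PosSemidef := by
    have := Matrix.posSemidef_conjTranspose_mul_self R
    rwa [hR.1.eq] at this
  have h := dotProduct_mulVec_kronecker_mono_left hS.posSemidef_mul_self_sub hRR x
  rwa [← mulVec_kronecker_dotProduct_self hS hR, Matrix.smul_kronecker, Matrix.smul_mulVec,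
    dotProduct_smul, smul_eq_mul] at h

theorem Matrix.PosDef.mul_self {R : Matrix n n ℝ} (hR : R.PosDef) : (R * R).PosDef := by
  have h : (R * R).PosSemidef := by
    have := Matrix.posSemidef_conjTranspose_mul_self R
    rwa [hR.1.eq] at this
  exact h.posDef_iff_isUnit.2 (hR.isUnit.mul hR.isUnit)

/-- The spectral norm of a positive definite Kronecker product. -/
theorem specNorm_kronecker_le [Nonempty m] [Nonempty n] {S : Matrix m m ℝ} {R : Matrix n n ℝ}
    (hS : S.PosDef) (hR : R.PosDef) : specNorm (S ⊗ₖ R) ≤ lamMax S * lamMax R := by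
  have hΛ : 0 < lamMax S * lamMax R := mul_pos hS.lamMax_pos hR.lamMax_pos
  set Λ := lamMax S * lamMax R
  set B := S ⊗ₖ R
  have hBpd : B.PosDef := hS.kronecker hR
  refine ContinuousLinearMap.opNorm_le_bound _ hΛ.le fun X => ?_
  have hΛB : (Λ • (1 : Matrix (m × n) (m × n) ℝ) - B).PosSemidef := by
    refine .of_dotProduct_mulVec_nonneg
      (Matrix.IsHermitian.sub (by simp [Matrix.IsHermitian]) hBpd.1) fun x => ?_
    rw [star_trivial, Matrix.sub_mulVec, dotProduct_sub, Matrix.smul_mulVec, Matrix.one_mulVec,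
      dotProduct_smul, smul_eq_mul, sub_nonneg]
    exact dotProduct_mulVec_kronecker_le hS hR x
  set C := Λ • (1 : Matrix (m × n) (m × n) ℝ) - B with hC
  -- `B` and `C = Λ - B` commute and sum to `Λ`, so `BCB + CBC = Λ BC = Λ(ΛB - B²)` is positive
  -- semidefinite. Thus `|Bx|² ≤ Λ x · Bx ≤ Λ² |x|²`.
  have h1 := (hΛB.conjTranspose_mul_mul_same B).add (hBpd.posSemidef.conjTranspose_mul_mul_same C)
  rw [hBpd.1.eq, hΛB.1.eq] at h1
  have h2 : B * C * B + C * B * C = Λ • (Λ • B - B * B) := by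
    simp only [hC, mul_sub, sub_mul, smul_sub, Matrix.smul_mul, Matrix.mul_smul, one_mul, mul_one]
    abel
  rw [h2] at h1
  have h3 := h1.dotProduct_mulVec_self_nonneg X.ofLp
  rw [Matrix.smul_mulVec, dotProduct_smul, Matrix.sub_mulVec, dotProduct_sub, smul_eq_mul,
    Matrix.smul_mulVec, dotProduct_smul, smul_eq_mul, ← Matrix.mulVec_mulVec] at h3
  have h4 := nonneg_of_mul_nonneg_right h3 hΛ
  have h5 : X.ofLp ⬝ᵥ B *ᵥ X.ofLp ≤ Λ * (X.ofLp ⬝ᵥ X.ofLp) :=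
    dotProduct_mulVec_kronecker_le hS hR X.ofLp
  have hn : ∀ Z : EuclideanSpace ℝ (m × n), ‖Z‖ ^ 2 = Z.ofLp ⬝ᵥ Z.ofLp := fun Z => by
    rw [EuclideanSpace.real_norm_sq_eq]
    simp [dotProduct, sq]
  refine abs_le_of_sq_le_sq' ?_ (by positivity) |>.2
  rw [mul_pow, hn, hn, Matrix.ofLp_toEuclideanCLM, hBpd.mulVec_dotProduct_comm X.ofLp]
  nlinarith

end Spectral

/-! ### Decay of the quadratic Lyapunov function -/

section Decay

/-- The left side is `x · (S ⊗ GA) x`, which equals its transpose `x · (S ⊗ AᵀG) x`. Averaging the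
two brings in `GA + AᵀG`, and `S ⊗ _` preserves the comparison with `2G²`. -/
theorem dotProduct_kronecker_mulVec_one_kronecker_le {m n : Type*} [Fintype m]
    [DecidableEq m] [Fintype n] {S : Matrix m m ℝ} {A G : Matrix n n ℝ}
    (hS : S.PosDef) (hG : G.PosDef)
    (hGA : (-(Gᵀ * A + Aᵀ * G - (2 : ℝ) • (Gᵀ * G))).PosDef) (x : m × n → ℝ) :
    ((S ⊗ₖ G) *ᵥ x) ⬝ᵥ ((1 : Matrix m m ℝ) ⊗ₖ A) *ᵥ x ≤ x ⬝ᵥ (S ⊗ₖ (G * G)) *ᵥ x := by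
  have h1 : ((S ⊗ₖ G) *ᵥ x) ⬝ᵥ ((1 : Matrix m m ℝ) ⊗ₖ A) *ᵥ x = x ⬝ᵥ (S ⊗ₖ (G * A)) *ᵥ x := by
    rw [(hS.kronecker hG).mulVec_dotProduct_comm, Matrix.mulVec_mulVec,
      ← Matrix.mul_kronecker_mul, mul_one]
  have h2 : x ⬝ᵥ (S ⊗ₖ (G * A)) *ᵥ x = x ⬝ᵥ (S ⊗ₖ (Aᵀ * G)) *ᵥ x := by
    rw [Matrix.dotProduct_mulVec, ← Matrix.mulVec_transpose, ← Matrix.kroneckerMap_transpose,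
      Matrix.transpose_mul, hS.transpose_eq, hG.transpose_eq, dotProduct_comm]
  rw [hG.transpose_eq] at hGA
  have h3 := (hS.kronecker hGA).posSemidef.dotProduct_mulVec_self_nonneg x
  have h4 : S ⊗ₖ (-(G * A + Aᵀ * G - (2 : ℝ) • (G * G)))
      = (2 : ℝ) • (S ⊗ₖ (G * G)) - S ⊗ₖ (G * A) - S ⊗ₖ (Aᵀ * G) := by
    ext i j
    simp only [Matrix.kroneckerMap_apply, Matrix.neg_apply, Matrix.sub_apply, Matrix.add_apply,
      Matrix.smul_apply, smul_eq_mul]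
    ring
  rw [h4, Matrix.sub_mulVec, Matrix.sub_mulVec, Matrix.smul_mulVec, dotProduct_sub,
    dotProduct_sub, dotProduct_smul, smul_eq_mul] at h3
  linarith

variable {m n : Type*} [Fintype m] [DecidableEq m] [Fintype n] [DecidableEq n]

theorem euclideanSpace_norm_sq_eq_dotProduct {ι : Type*} [Fintype ι] (x : EuclideanSpace ℝ ι) :
    ‖x‖ ^ 2 = x.ofLp ⬝ᵥ x.ofLp := by
  rw [EuclideanSpace.real_norm_sq_eq]
  simp [dotProduct, sq]

theorem dotProduct_le_norm_mul_norm {ι : Type*} [Fintype ι] (x y : EuclideanSpace ℝ ι) :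
    x.ofLp ⬝ᵥ y.ofLp ≤ ‖x‖ * ‖y‖ := by
  have h := real_inner_le_norm x y
  rwa [EuclideanSpace.inner_eq_star_dotProduct, star_trivial, dotProduct_comm] at h

theorem norm_le_sum_abs {ι : Type*} [Fintype ι] (x : EuclideanSpace ℝ ι) :
    ‖x‖ ≤ ∑ r, |x r| := by
  refine abs_le_of_sq_le_sq' ?_ (Finset.sum_nonneg fun _ _ => abs_nonneg _) |>.2
  rw [EuclideanSpace.real_norm_sq_eq]
  simpa using Finset.sum_sq_le_sq_sum_of_nonneg (s := Finset.univ) (f := fun r => |x r|)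
    fun _ _ => abs_nonneg _

/-- Under the gain condition on `ω`, the continuous part of the error dynamics does not increase
the Lyapunov function `x · (S ⊗ G) x`. -/
theorem dotProduct_continuous_part_nonpos [Nonempty m] [Nonempty n] {S : Matrix m m ℝ}
    {A G : Matrix n n ℝ} (hS : S.PosDef) (hG : G.PosDef)
    (hGA : (-(Gᵀ * A + Aᵀ * G - (2 : ℝ) • (Gᵀ * G))).PosDef) {lf : ℝ≥0} {ω : ℝ}
    (hω : ω ≥ 1 / lamMin S * (1 + lf * specNorm (S ⊗ₖ G) / (lamMin S * lamMin (Gᵀ * G))))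
    (x D : EuclideanSpace ℝ (m × n)) (hD : ‖D‖ ≤ lf * ‖x‖) :
    ((S ⊗ₖ G) *ᵥ x.ofLp) ⬝ᵥ
      (D.ofLp + ((1 : Matrix m m ℝ) ⊗ₖ A) *ᵥ x.ofLp - ω • ((S ⊗ₖ G) *ᵥ x.ofLp)) ≤ 0 := by
  have hGG := hG.mul_self
  rw [hG.transpose_eq] at hω
  set w : EuclideanSpace ℝ (m × n) := WithLp.toLp 2 ((S ⊗ₖ G) *ᵥ x.ofLp)
  have hww : ‖w‖ ^ 2 = ((S ⊗ₖ G) *ᵥ x.ofLp) ⬝ᵥ ((S ⊗ₖ G) *ᵥ x.ofLp) :=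
    euclideanSpace_norm_sq_eq_dotProduct w
  have hσ : ‖w‖ ≤ specNorm (S ⊗ₖ G) * ‖x‖ :=
    (Matrix.toEuclideanCLM (n := m × n) (𝕜 := ℝ) (S ⊗ₖ G)).le_opNorm x
  have h1 : ((S ⊗ₖ G) *ᵥ x.ofLp) ⬝ᵥ D.ofLp ≤ ‖w‖ * ‖D‖ := dotProduct_le_norm_mul_norm w D
  have h2 := dotProduct_kronecker_mulVec_one_kronecker_le hS hG hGA x.ofLp
  have h3 := lamMin_mul_dotProduct_le_sq hS hG x.ofLp
  have h4 := le_dotProduct_mulVec_kronecker hS hGG x.ofLp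
  rw [← euclideanSpace_norm_sq_eq_dotProduct] at h4
  rw [← hww] at h3
  rw [dotProduct_sub, dotProduct_add, dotProduct_smul, ← hww, smul_eq_mul]
  set q := x.ofLp ⬝ᵥ (S ⊗ₖ (G * G)) *ᵥ x.ofLp
  have hl := hS.lamMin_pos
  have hμ := hGG.lamMin_pos
  have hσ0 : 0 ≤ specNorm (S ⊗ₖ G) := norm_nonneg _
  set l := lamMin S
  set μ := lamMin (G * G)
  set σ := specNorm (S ⊗ₖ G)
  have h5 : ‖w‖ * ‖D‖ ≤ lf * σ * ‖x‖ ^ 2 := by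
    calc ‖w‖ * ‖D‖ ≤ (σ * ‖x‖) * (lf * ‖x‖) := by gcongr
      _ = lf * σ * ‖x‖ ^ 2 := by ring
  have h6 : l * (l * μ * ‖x‖ ^ 2) ≤ ‖w‖ ^ 2 := (mul_le_mul_of_nonneg_left h4 hl.le).trans h3
  -- The two summands of the gain bound have separate tasks: `1/l` pays for the `A`-term `q`, and
  -- `lf σ / (l² μ)` pays for the Lipschitz term through `l² μ |x|² ≤ |w|²`.
  have h7 : lf * σ * ‖x‖ ^ 2 + q ≤ (1 / l * (1 + lf * σ / (l * μ))) * ‖w‖ ^ 2 := by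
    have h8 : q ≤ 1 / l * ‖w‖ ^ 2 := by
      rw [one_div, ← div_eq_inv_mul, le_div_iff₀ hl]
      linarith
    have h9 : lf * σ * ‖x‖ ^ 2 ≤ (lf * σ / (l * (l * μ))) * ‖w‖ ^ 2 := by
      calc lf * σ * ‖x‖ ^ 2 = (lf * σ / (l * (l * μ))) * (l * (l * μ * ‖x‖ ^ 2)) := by
            field_simp
        _ ≤ _ := by gcongr
    calc _ ≤ (lf * σ / (l * (l * μ))) * ‖w‖ ^ 2 + 1 / l * ‖w‖ ^ 2 := add_le_add h9 h8
      _ = _ := by field_simp; ring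
  have h10 := mul_le_mul_of_nonneg_right hω (sq_nonneg ‖w‖)
  linarith

/-- The sign feedback dominates a disturbance bounded by `κ`. -/
theorem sign_part_le [Nonempty m] [Nonempty n] {S : Matrix m m ℝ} {G : Matrix n n ℝ}
    (hS : S.PosDef) (hG : G.PosDef) {θ κ : ℝ} (hθ : 0 ≤ θ) (hκ : 0 ≤ κ)
    (x : EuclideanSpace ℝ (m × n)) :
    -(θ * ∑ r, |((S ⊗ₖ G) *ᵥ x.ofLp) r|)
        + ‖(WithLp.toLp 2 ((S ⊗ₖ G) *ᵥ x.ofLp) : EuclideanSpace ℝ (m × n))‖ * κ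
      ≤ -((θ * lamMin S * lamMin G - specNorm (S ⊗ₖ G) * κ) * ‖x‖) := by
  set w : EuclideanSpace ℝ (m × n) := WithLp.toLp 2 ((S ⊗ₖ G) *ᵥ x.ofLp)
  have h1 : ‖w‖ ≤ ∑ r, |((S ⊗ₖ G) *ᵥ x.ofLp) r| := norm_le_sum_abs w
  have h2 : ‖w‖ ≤ specNorm (S ⊗ₖ G) * ‖x‖ :=
    (Matrix.toEuclideanCLM (n := m × n) (𝕜 := ℝ) (S ⊗ₖ G)).le_opNorm x
  -- Cauchy–Schwarz turns the lower bound on the quadratic form `x · w` into one on `|w|`; the case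
  -- `x = 0` is separate because `|x|` is cancelled.
  have h3 : lamMin S * lamMin G * ‖x‖ ≤ ‖w‖ := by
    have h4 := le_dotProduct_mulVec_kronecker hS hG x.ofLp
    rw [← euclideanSpace_norm_sq_eq_dotProduct] at h4
    have h5 : x.ofLp ⬝ᵥ (S ⊗ₖ G) *ᵥ x.ofLp ≤ ‖x‖ * ‖w‖ := dotProduct_le_norm_mul_norm x w
    rcases (norm_nonneg x).eq_or_lt with h0 | h0
    · rw [← h0, mul_zero]
      exact norm_nonneg _
    · refine le_of_mul_le_mul_left ?_ h0
      linarith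
  have h6 := mul_le_mul_of_nonneg_left (h3.trans h1) hθ
  have h7 := mul_le_mul_of_nonneg_right h2 hκ
  linarith

/-- The gain condition is stated with the product of largest eigenvalues, which dominates the
spectral norm in `phi`. -/
theorem phi_expression_pos [Nonempty m] [Nonempty n] {S : Matrix m m ℝ} {G : Matrix n n ℝ}
    (hS : S.PosDef) (hG : G.PosDef) {θ κ d : ℝ} (hκ : 0 ≤ κ) (hd : κ ≤ d)
    (hθ : θ > lamMax S * lamMax G / (lamMin S * lamMin G) * d) :
    0 < θ * lamMin S * lamMin G - specNorm (S ⊗ₖ G) * κ := by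
  have hl : 0 < lamMin S * lamMin G := mul_pos hS.lamMin_pos hG.lamMin_pos
  have h1 : specNorm (S ⊗ₖ G) * κ ≤ lamMax S * lamMax G * d :=
    mul_le_mul (specNorm_kronecker_le hS hG) hd hκ (mul_pos hS.lamMax_pos hG.lamMax_pos).le
  rw [gt_iff_lt, div_mul_eq_mul_div, div_lt_iff₀ hl] at hθ
  linarith

end Decay

/-! ### The network -/

section Network

/-- Transposed selection is extension by zero. -/
theorem selMatrix_transpose_mulVec {V : Type*} [DecidableEq V] (N : ℕ) (s : Set V)
    [Fintype s] [DecidablePred (· ∈ s)] (y : s × Fin N → ℝ) (a : V) (c : Fin N) :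
    ((selMatrix N s)ᵀ *ᵥ y) (a, c) = if h : a ∈ s then y (⟨a, h⟩, c) else 0 := by
  simp only [selMatrix, Matrix.mulVec, dotProduct, Matrix.transpose_apply, Matrix.of_apply,
    Prod.mk.injEq, ite_mul, one_mul, zero_mul]
  split_ifs with h
  · rw [Finset.sum_eq_single (⟨a, h⟩, c)]
    · simp
    · rintro ⟨⟨b, hb⟩, c'⟩ _ hne
      refine if_neg ?_
      rintro ⟨h1, h2⟩
      simp only at h1 h2
      subst h1 h2
      exact hne rfl
    · simp
  · refine Finset.sum_eq_zero fun r _ => if_neg ?_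
    rintro ⟨h1, -⟩
    exact h (h1 ▸ r.1.2)

theorem mem_kHop_comm {V : Type*} (𝒢 : SimpleGraph V) (k : ℕ) {i l : V} :
    l ∈ kHop 𝒢 k i ↔ i ∈ kHop 𝒢 k l := by
  simp only [kHop, mem_ofPred_eq, 𝒢.dist_comm (u := i)]

variable {V : Type*} [Fintype V] [DecidableEq V]

theorem selMatrix_mulVec (N : ℕ) (s : Set V) (v : V × Fin N → ℝ) (r : s × Fin N) :
    (selMatrix N s *ᵥ v) r = v (r.1.1, r.2) := by
  simp [selMatrix, Matrix.mulVec, dotProduct]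

variable (𝒢 : SimpleGraph V) [DecidableRel 𝒢.Adj] (k N : ℕ)

/-- The innovation of agent `l` about agent `i`, as a sum over the neighbours of `l`. -/
theorem innovation_kHopSwap_apply (Z : NetState 𝒢 k N) (i : V) (l : kHop 𝒢 k i) (c : Fin N) :
    innovation 𝒢 k N Z l (kHopSwap 𝒢 k l, c)
      = ∑ j ∈ 𝒢.neighborFinset l.1,
        ((if h : j ∈ kHop 𝒢 k i then
            estError 𝒢 k N i Z (l, c) - estError 𝒢 k N i Z (⟨j, h⟩, c) else 0)
          + if 𝒢.Adj i j then estError 𝒢 k N i Z (l, c) else 0) := by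
  simp only [innovation, Finset.sum_apply]
  refine Finset.sum_congr rfl fun j _ => ?_
  simp only [Pi.add_apply, selHop, selNbr, selMatrix_mulVec, Pi.neg_apply,
    ← Matrix.mulVec_mulVec, selMatrix_transpose_mulVec, kHopSwap, estError]
  -- After the zero extensions, neighbour `j` contributes only if `i` is a `k`-hop or a `1`-hop
  -- neighbour of `j`. Both relations are symmetric, so the conditions become conditions on `j`
  -- relative to `i`.
  have hl : i ∈ kHop 𝒢 k l.1 := (mem_kHop_comm 𝒢 k).1 l.2
  have hj : i ∈ kHop 𝒢 k j ↔ j ∈ kHop 𝒢 k i := mem_kHop_comm 𝒢 k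
  have hj' : i ∈ 𝒢.neighborSet j ↔ 𝒢.Adj i j := by
    rw [SimpleGraph.mem_neighborSet, 𝒢.adj_comm]
  simp only [hl, hj, hj', dite_true]
  split_ifs <;> simp <;> ring

/-- The sum has the shape of `innovation_kHopSwap_apply`: neighbours of `l` inside the `k-`hop set
give the Laplacian, common neighbours with `i` the diagonal. -/
theorem Mkc_mulVec_apply (i : V) (y : kHop 𝒢 k i → ℝ) (l : kHop 𝒢 k i) :
    (Mkc 𝒢 k i *ᵥ y) l = ∑ j ∈ 𝒢.neighborFinset l.1,
        ((if h : j ∈ kHop 𝒢 k i then y l - y ⟨j, h⟩ else 0) + if 𝒢.Adj i j then y l else 0) := by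
  rw [Mkc, Matrix.add_mulVec, Pi.add_apply, SimpleGraph.lapMatrix_mulVec_apply,
    Matrix.mulVec_diagonal, Finset.sum_add_distrib]
  congr 1
  · rw [← SimpleGraph.card_neighborFinset_eq_degree, ← nsmul_eq_mul, ← Finset.sum_const,
      ← Finset.sum_sub_distrib]
    refine (Finset.sum_of_injOn (fun j => j.1) Subtype.val_injective.injOn ?_ ?_ ?_)
    · intro j hj
      simpa using hj
    · intro j hj hnot
      rw [dif_neg]
      intro h
      exact hnot ⟨⟨j, h⟩, by simpa using hj, rfl⟩
    · intro j _
      simp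
  · rw [← Finset.sum_filter, Finset.sum_const, nsmul_eq_mul]
    congr 2
    congr 1
    ext j
    simp

theorem kronecker_innovation_kHopSwap (G : Matrix (Fin N) (Fin N) ℝ) (Z : NetState 𝒢 k N) (i : V)
    (l : kHop 𝒢 k i) (c : Fin N) :
    (((1 : Matrix (kHop 𝒢 k l.1) (kHop 𝒢 k l.1) ℝ) ⊗ₖ G) *ᵥ innovation 𝒢 k N Z l)
        (kHopSwap 𝒢 k l, c)
      = ((Mkc 𝒢 k i ⊗ₖ G) *ᵥ (estError 𝒢 k N i Z).ofLp) (l, c) := by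
  have h1 : ∀ c', innovation 𝒢 k N Z l (kHopSwap 𝒢 k l, c')
      = (Mkc 𝒢 k i *ᵥ fun l' => estError 𝒢 k N i Z (l', c')) l := fun c' => by
    rw [innovation_kHopSwap_apply, Mkc_mulVec_apply]
  simp only [Matrix.mulVec, dotProduct, Matrix.kroneckerMap_apply, Fintype.sum_prod_type]
  rw [Finset.sum_eq_single (kHopSwap 𝒢 k l)]
  · simp only [Matrix.one_apply_eq, one_mul, h1]
    simp only [Matrix.mulVec, dotProduct, Finset.mul_sum]
    rw [Finset.sum_comm]
    refine Finset.sum_congr rfl fun _ _ => Finset.sum_congr rfl fun _ _ => ?_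
    ring
  · intro b _ hb
    simp [Matrix.one_apply_ne hb.symm]
  · simp

/-- A kernel vector annihilates both semidefinite summands: it is constant along edges of the
`k`-hop set and zero at vertices sharing a neighbour with `i`. Along a geodesic from `i`, the vertex
at distance 2 is of the second kind, and all later ones up to `l` stay in the `k`-hop set, so the
zero propagates to `l`. -/
theorem posDef_Mkc (h𝒢 : 𝒢.Connected) (i : V) : (Mkc 𝒢 k i).PosDef := by
  have hL := SimpleGraph.posSemidef_lapMatrix ℝ (𝒢.induce (kHop 𝒢 k i))
  have hH : (Matrix.diagonal fun l : kHop 𝒢 k i =>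
      ((𝒢.neighborFinset l.1 ∩ 𝒢.neighborFinset i).card : ℝ)).PosSemidef :=
    .diagonal fun _ => Nat.cast_nonneg _
  have hM : (Mkc 𝒢 k i).PosSemidef := hL.add hH
  refine .of_dotProduct_mulVec_pos hM.1 fun y hy => ?_
  refine lt_of_le_of_ne (hM.dotProduct_mulVec_nonneg y) fun h0 => hy ?_
  rw [star_trivial, Mkc, Matrix.add_mulVec, dotProduct_add] at h0
  have hL0 := hL.dotProduct_mulVec_self_nonneg y
  have hH0 := hH.dotProduct_mulVec_self_nonneg y
  have hadj := ((𝒢.induce (kHop 𝒢 k i)).lapMatrix_toLinearMap₂'_apply'_eq_zero_iff_forall_adj ℝ y).1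
    (by rw [Matrix.toLinearMap₂'_apply']; linarith)
  have hcommon : ∀ l, 0 < (𝒢.neighborFinset l.1 ∩ 𝒢.neighborFinset i).card → y l = 0 := by
    have h1 : ∑ l, y l * (((𝒢.neighborFinset l.1 ∩ 𝒢.neighborFinset i).card : ℝ) * y l) = 0 := by
      have : y ⬝ᵥ (Matrix.diagonal fun l : kHop 𝒢 k i =>
        ((𝒢.neighborFinset l.1 ∩ 𝒢.neighborFinset i).card : ℝ)) *ᵥ y = 0 := by linarith
      simpa [dotProduct, Matrix.mulVec_diagonal] using this
    intro l hl
    rw [Finset.sum_eq_zero_iff_of_nonneg fun l _ => by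
      nlinarith [mul_nonneg (Nat.cast_nonneg (α := ℝ)
        (𝒢.neighborFinset l.1 ∩ 𝒢.neighborFinset i).card) (mul_self_nonneg (y l))]] at h1
    have h2 := h1 l (Finset.mem_univ _)
    have h3 : ((𝒢.neighborFinset l.1 ∩ 𝒢.neighborFinset i).card : ℝ) ≠ 0 := by
      exact_mod_cast hl.ne'
    simpa [h3] using h2
  have key : ∀ n, ∀ l : kHop 𝒢 k i, 𝒢.dist i l = n + 2 → y l = 0 := by
    intro n
    induction n with
    | zero =>
      intro l hl
      obtain ⟨p, hp⟩ := h𝒢.exists_walk_length_eq_dist i l.1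
      -- The midpoint of a geodesic of length 2 is a common neighbour.
      refine hcommon l (Finset.card_pos.2 ⟨p.getVert 1, ?_⟩)
      have h1 := p.adj_getVert_succ (i := 0) (by omega)
      have h2 := p.adj_getVert_succ (i := 1) (by omega)
      rw [p.getVert_zero] at h1
      rw [show 1 + 1 = p.length by omega, p.getVert_length] at h2
      simp only [Finset.mem_inter, SimpleGraph.mem_neighborFinset]
      exact ⟨h2.symm, h1⟩
    | succ n ih =>
      intro l hl
      obtain ⟨p, hp⟩ := h𝒢.exists_walk_length_eq_dist i l.1
      have h2 := p.adj_getVert_succ (i := n + 2) (by omega)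
      rw [show n + 2 + 1 = p.length by omega, p.getVert_length] at h2
      have h3 : 𝒢.dist i (p.getVert (n + 2)) ≤ n + 2 := by
        have := 𝒢.dist_le (p.take (n + 2))
        simp only [SimpleGraph.Walk.take_length] at this
        omega
      have h4 : 𝒢.dist i (p.getVert (n + 2)) = n + 2 := by
        have h5 := h𝒢.dist_triangle (u := i) (v := p.getVert (n + 2)) (w := l.1)
        rw [SimpleGraph.dist_eq_one_iff_adj.2 h2] at h5
        omega
      have h5 : 𝒢.dist i l ≤ k := l.2.2
      let j : kHop 𝒢 k i := ⟨p.getVert (n + 2), by simp only [kHop, mem_ofPred_eq]; omega⟩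
      have h6 : y j = 0 := ih j h4
      rw [← hadj j l h2, h6]
  ext l
  have hl : 2 ≤ 𝒢.dist i l := l.2.1
  exact key (𝒢.dist i l - 2) l (by omega)

end Network

/-! ### Error dynamics and decay along Filippov velocities -/

section ErrorDynamics

theorem one_kronecker_mulVec_apply {m n : Type*} [Fintype m] [DecidableEq m] [Fintype n]
    (A : Matrix n n ℝ) (x : m × n → ℝ) (a : m) (c : n) :
    (((1 : Matrix m m ℝ) ⊗ₖ A) *ᵥ x) (a, c) = ∑ c', A c c' * x (a, c') := by
  simp only [Matrix.mulVec, dotProduct, Matrix.kroneckerMap_apply, Fintype.sum_prod_type]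
  rw [Finset.sum_eq_single a]
  · simp
  · intro b _ hb
    simp [Matrix.one_apply_ne hb.symm]
  · simp

theorem diagonal_kronecker_one_mulVec_apply {m n : Type*} [Fintype m] [DecidableEq m] [Fintype n]
    [DecidableEq n] (d : m → ℝ) (x : m × n → ℝ) (r : m × n) :
    ((Matrix.diagonal d ⊗ₖ (1 : Matrix n n ℝ)) *ᵥ x) r = d r.1 * x r := by
  rw [← Matrix.diagonal_one, Matrix.diagonal_kronecker_diagonal, Matrix.mulVec_diagonal, mul_one]

/-- Where `h p ≠ 0` the sign is locally constant; where `h p = 0` the weight kills the ambiguous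
sign. This is what removes the discontinuity of the feedback from the Lyapunov estimate. -/
theorem eventually_mul_sgn_eq_abs {E : Type*} [TopologicalSpace E] {h : E → ℝ} {p : E}
    (hh : ContinuousAt h p) : ∀ᶠ q in 𝓝 p, h p * sgn (h q) = |h p| := by
  rcases lt_trichotomy (h p) 0 with h0 | h0 | h0
  · filter_upwards [hh.eventually (gt_mem_nhds h0)] with q hq
    rw [sgn, if_neg hq.not_ge, abs_of_neg h0, mul_neg_one]
  · simp [h0]
  · filter_upwards [hh.eventually (lt_mem_nhds h0)] with q hq
    rw [sgn, if_pos (le_of_lt hq), abs_of_pos h0, mul_one]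

variable {V : Type*} [Fintype V] (𝒢 : SimpleGraph V) (k N : ℕ)

/-- The estimation error, as a continuous linear map of the network state. -/
noncomputable def estErrorCLM (i : V) : NetState 𝒢 k N →L[ℝ] Stack N (kHop 𝒢 k i) :=
  LinearMap.toContinuousLinearMap
    { toFun := estError 𝒢 k N i
      map_add' := fun Z Z' => by
        ext r
        simp only [estError, Prod.fst_add, Prod.snd_add, Pi.add_apply, PiLp.add_apply]
        ring
      map_smul' := fun a Z => by
        ext r
        simp only [estError, Prod.smul_fst, Prod.smul_snd, Pi.smul_apply, PiLp.smul_apply,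
          smul_eq_mul, RingHom.id_apply]
        ring }

@[simp]
theorem estErrorCLM_apply (i : V) (Z : NetState 𝒢 k N) :
    estErrorCLM 𝒢 k N i Z = estError 𝒢 k N i Z := rfl

/-- The contribution of the nonlinearity `f` to the error dynamics. -/
noncomputable def driftError (f : EuclideanSpace ℝ (Fin N) → EuclideanSpace ℝ (Fin N)) (i : V)
    (Z : NetState 𝒢 k N) : Stack N (kHop 𝒢 k i) :=
  estError 𝒢 k N i (stackMap f Z.1, fun l => stackMap f (Z.2 l))

theorem norm_stack_sq {ι : Type*} [Fintype ι] {N : ℕ} (z : Stack N ι) :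
    ‖z‖ ^ 2 = ∑ a, ‖block z a‖ ^ 2 := by
  simp only [EuclideanSpace.real_norm_sq_eq, Fintype.sum_prod_type, block]

theorem norm_driftError_le {f : EuclideanSpace ℝ (Fin N) → EuclideanSpace ℝ (Fin N)} {lf : ℝ≥0}
    (hf : LipschitzWith lf f) (i : V) (Z : NetState 𝒢 k N) :
    ‖driftError 𝒢 k N f i Z‖ ≤ lf * ‖estError 𝒢 k N i Z‖ := by
  refine abs_le_of_sq_le_sq' ?_ (by positivity) |>.2
  rw [mul_pow, norm_stack_sq, norm_stack_sq, Finset.mul_sum]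
  refine Finset.sum_le_sum fun l _ => ?_
  have h1 : block (driftError 𝒢 k N f i Z) l
      = f (block Z.1 i) - f (block (Z.2 l.1) (kHopSwap 𝒢 k l)) := by
    ext c
    simp [block, driftError, estError, stackMap]
  have h2 : block (estError 𝒢 k N i Z) l = block Z.1 i - block (Z.2 l.1) (kHopSwap 𝒢 k l) := by
    ext c
    simp [block, estError]
  rw [h1, h2, ← mul_pow, ← dist_eq_norm, ← dist_eq_norm]
  gcongr
  exact hf.dist_le_mul _ _

theorem continuous_driftError {f : EuclideanSpace ℝ (Fin N) → EuclideanSpace ℝ (Fin N)}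
    (hf : Continuous f) (i : V) : Continuous (driftError 𝒢 k N f i) := by
  have hb : ∀ {ι : Type _} (a : ι), Continuous fun z : Stack N ι => block z a := fun a => by
    unfold block
    fun_prop
  have hs : ∀ {ι : Type _}, Continuous fun z : Stack N ι => stackMap f z := by
    intro ι
    unfold stackMap
    refine (PiLp.continuous_toLp 2 _).comp (continuous_pi fun r => ?_)
    exact (EuclideanSpace.proj (𝕜 := ℝ) r.2).continuous.comp (hf.comp (hb r.1))
  refine (estErrorCLM 𝒢 k N i).continuous.comp (Continuous.prodMk (hs.comp continuous_fst) ?_)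
  exact continuous_pi fun l => hs.comp ((continuous_apply l).comp continuous_snd)

variable [DecidableEq V] [DecidableRel 𝒢.Adj]

/-- `(M_i ⊗ G) x̃_i`. -/
noncomputable def weightedError (G : Matrix (Fin N) (Fin N) ℝ) (i : V) (Z : NetState 𝒢 k N) :
    Stack N (kHop 𝒢 k i) :=
  WithLp.toLp 2 ((Mkc 𝒢 k i ⊗ₖ G) *ᵥ (estError 𝒢 k N i Z).ofLp)

theorem continuous_weightedError (G : Matrix (Fin N) (Fin N) ℝ) (i : V) :
    Continuous (weightedError 𝒢 k N G i) :=
  (Matrix.toEuclideanCLM (n := kHop 𝒢 k i × Fin N) (𝕜 := ℝ) (Mkc 𝒢 k i ⊗ₖ G)).continuous.comp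
    (estErrorCLM 𝒢 k N i).continuous

/-- The closed-loop error dynamics. -/
theorem estError_networkField_apply
    (f : EuclideanSpace ℝ (Fin N) → EuclideanSpace ℝ (Fin N))
    (A G : Matrix (Fin N) (Fin N) ℝ) (ω θ : V → ℝ)
    (u : ℝ × NetState 𝒢 k N → Stack N V)
    (uhat : ℝ × NetState 𝒢 k N → (i : V) → Stack N (kHop 𝒢 k i))
    (p : ℝ × NetState 𝒢 k N) (i : V) (r : kHop 𝒢 k i × Fin N) :
    estError 𝒢 k N i (networkField 𝒢 k N f A G ω θ u uhat p) r
      = (driftError 𝒢 k N f i p.2).ofLp r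
        + (((1 : Matrix (kHop 𝒢 k i) (kHop 𝒢 k i) ℝ) ⊗ₖ A) *ᵥ (estError 𝒢 k N i p.2).ofLp) r
        - ω i * weightedError 𝒢 k N G i p.2 r - θ i * sgn (weightedError 𝒢 k N G i p.2 r)
        + estError 𝒢 k N i (u p, uhat p) r := by
  obtain ⟨l, c⟩ := r
  have h1 := kronecker_innovation_kHopSwap 𝒢 k N G p.2 i l c
  simp only [estError, networkField, agentField, observerField, driftError, weightedError,
    PiLp.add_apply, Pi.add_apply, diagonal_kronecker_one_mulVec_apply]
  rw [h1]
  simp only [one_kronecker_mulVec_apply, kHopSwap, mul_sub, Finset.sum_sub_distrib, estError]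
  ring

/-- Along the Filippov dynamics the error satisfies the Lyapunov decrease condition. -/
theorem weightedError_dotProduct_le (h𝒢 : 𝒢.Connected) (hN : 0 < N)
    {f : EuclideanSpace ℝ (Fin N) → EuclideanSpace ℝ (Fin N)} {lf : ℝ≥0} (hf : LipschitzWith lf f)
    {A G : Matrix (Fin N) (Fin N) ℝ} (hG : G.PosDef) {ω θ : V → ℝ}
    {u : ℝ × NetState 𝒢 k N → Stack N V}
    {uhat : ℝ × NetState 𝒢 k N → (i : V) → Stack N (kHop 𝒢 k i)}
    (hu : IsLocallyBounded u) (huhat : IsLocallyBounded uhat)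
    {i : V} (hi : (kHop 𝒢 k i).Nonempty)
    (hω : ω i ≥ 1 / lamMin (Mkc 𝒢 k i) *
      (1 + lf * specNorm (Mkc 𝒢 k i ⊗ₖ G) / (lamMin (Mkc 𝒢 k i) * lamMin (Gᵀ * G))))
    (hGA : (-(Gᵀ * A + Aᵀ * G - (2 : ℝ) • (Gᵀ * G))).PosDef)
    (hθ : 0 ≤ θ i) {κ : ℝ} (hκ : 0 ≤ κ) {p : ℝ × NetState 𝒢 k N}
    (hκp : ∀ z ∈ filippovMap (fun p => estError 𝒢 k N i (u p, uhat p)) p, ‖z‖ ≤ κ)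
    {v : NetState 𝒢 k N} (hv : v ∈ filippovMap (networkField 𝒢 k N f A G ω θ u uhat) p) :
    inner ℝ (weightedError 𝒢 k N G i p.2) (estError 𝒢 k N i v)
      ≤ -(phi 𝒢 k N G θ i κ * ‖estError 𝒢 k N i p.2‖) := by
  have : Nonempty (kHop 𝒢 k i) := hi.to_subtype
  have : Nonempty (Fin N) := ⟨⟨0, hN⟩⟩
  have hM := posDef_Mkc 𝒢 k h𝒢 i
  let w := fun q : ℝ × NetState 𝒢 k N => weightedError 𝒢 k N G i q.2
  have hwc : Continuous w := (continuous_weightedError 𝒢 k N G i).comp continuous_snd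
  -- The weight is taken at `p` and not at the nearby points `q`, so that `ψ` is a fixed linear
  -- functional.
  let ψ : Stack N (kHop 𝒢 k i) →L[ℝ] ℝ := innerSL ℝ (w p)
  let C : ℝ × NetState 𝒢 k N → Stack N (kHop 𝒢 k i) := fun q => driftError 𝒢 k N f i q.2
    + Matrix.toEuclideanCLM (n := kHop 𝒢 k i × Fin N) (𝕜 := ℝ)
        ((1 : Matrix (kHop 𝒢 k i) (kHop 𝒢 k i) ℝ) ⊗ₖ A) (estErrorCLM 𝒢 k N i q.2)
    - ω i • w q
  have hCc : Continuous C :=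
    (((continuous_driftError 𝒢 k N hf.continuous i).comp continuous_snd).add
      ((ContinuousLinearMap.continuous _).comp
        ((ContinuousLinearMap.continuous _).comp continuous_snd))).sub (hwc.fun_const_smul (ω i))
  have hCp : ψ (C p) ≤ 0 := by
    have h := dotProduct_continuous_part_nonpos hM hG hGA hω (estError 𝒢 k N i p.2)
      (driftError 𝒢 k N f i p.2) (norm_driftError_le 𝒢 k N hf i p.2)
    change inner ℝ (w p) (C p) ≤ 0
    rw [EuclideanSpace.inner_eq_star_dotProduct, star_trivial, dotProduct_comm]
    exact h
  have hsplit : ∀ q, ψ (estError 𝒢 k N i (networkField 𝒢 k N f A G ω θ u uhat q))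
      = ψ (C q) - θ i * ∑ r, w p r * sgn (w q r) + ψ (estError 𝒢 k N i (u q, uhat q)) := by
    intro q
    have hq : estError 𝒢 k N i (networkField 𝒢 k N f A G ω θ u uhat q)
        = C q - θ i • (WithLp.toLp 2 fun r => sgn (w q r)) + estError 𝒢 k N i (u q, uhat q) := by
      ext r
      rw [estError_networkField_apply]
      rfl
    have hs : ψ (WithLp.toLp 2 fun r => sgn (w q r)) = ∑ r, w p r * sgn (w q r) := by
      simp [ψ, PiLp.inner_apply, mul_comm]
    rw [hq, map_add, map_sub, map_smul, hs, smul_eq_mul]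
  have hub : ∃ U ∈ 𝓝 p, Bornology.IsBounded
      ((fun p => estError 𝒢 k N i (u p, uhat p)) '' U) := by
    obtain ⟨U₁, hU₁, hb₁⟩ := hu p
    obtain ⟨U₂, hU₂, hb₂⟩ := huhat p
    refine ⟨U₁ ∩ U₂, Filter.inter_mem hU₁ hU₂, ?_⟩
    refine ((estErrorCLM 𝒢 k N i).lipschitz.isBounded_image (hb₁.prod hb₂)).subset ?_
    rintro _ ⟨q, hq, rfl⟩
    exact ⟨(u q, uhat q), ⟨mem_image_of_mem _ hq.1, mem_image_of_mem _ hq.2⟩, rfl⟩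
  have hmain : ψ (estError 𝒢 k N i v) ≤ -(θ i * ∑ r, |w p r|) + ‖w p‖ * κ := by
    -- One half of `ε` covers the variation of the continuous part near `p`, the other makes the
    -- disturbance bound strict, as the transfer lemma requires.
    refine le_of_forall_pos_le_add fun ε hε => ?_
    obtain ⟨δ₁, hδ₁, M, hMnull, hball⟩ := exists_ball_diff_null_lt_of_filippovMap hub ψ
      (c := ‖w p‖ * κ + ε / 2) fun z hz => by
        have h1 : ψ z ≤ ‖w p‖ * ‖z‖ := real_inner_le_norm (w p) z
        have h2 := mul_le_mul_of_nonneg_left (hκp z hz) (norm_nonneg (w p))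
        linarith
    have hev : ∀ᶠ q in 𝓝 p, ψ (C q) < ε / 2 ∧ ∀ r, w p r * sgn (w q r) = |w p r| := by
      refine Filter.Eventually.and ?_ (Filter.eventually_all.2 fun r => ?_)
      · exact (ψ.continuous.comp hCc).continuousAt.eventually
          (gt_mem_nhds (hCp.trans_lt (half_pos hε)))
      · exact eventually_mul_sgn_eq_abs (h := fun q => w q r)
          ((EuclideanSpace.proj (𝕜 := ℝ) r).continuous.comp hwc).continuousAt
    obtain ⟨δ₂, hδ₂, hball₂⟩ := Metric.eventually_nhds_iff_ball.1 hev
    refine le_of_mem_filippovMap hv (ψ.comp (estErrorCLM 𝒢 k N i)) (lt_min hδ₁ hδ₂) hMnull ?_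
    rintro q ⟨hq, hqM⟩
    have h1 := hball q ⟨Metric.ball_subset_ball (min_le_left _ _) hq, hqM⟩
    obtain ⟨h2, h3⟩ := hball₂ q (Metric.ball_subset_ball (min_le_right _ _) hq)
    rw [ContinuousLinearMap.comp_apply, estErrorCLM_apply, hsplit,
      Finset.sum_congr rfl fun r _ => h3 r]
    linarith
  exact hmain.trans (sign_part_le hM hG hθ hκ (estError 𝒢 k N i p.2))

end ErrorDynamics

/-! ### Lyapunov argument along a solution -/

/-- A quadratic form along an absolutely continuous curve is absolutely continuous. -/
theorem AbsolutelyContinuousOnInterval.inner_clm_self {E : Type*} [NormedAddCommGroup E]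
    [InnerProductSpace ℝ E] [ProperSpace E] (T : E →L[ℝ] E) {y : ℝ → E} {a b : ℝ}
    (hy : AbsolutelyContinuousOnInterval y a b) :
    AbsolutelyContinuousOnInterval (fun t => inner ℝ (y t) (T (y t))) a b := by
  obtain ⟨R, hR⟩ := hy.exists_bound
  have hsmooth : ContDiffOn ℝ 1 (fun x : E => inner ℝ x (T x)) (Metric.closedBall 0 R) :=
    (contDiff_id.inner ℝ T.contDiff).contDiffOn
  obtain ⟨K, hK⟩ := hsmooth.exists_lipschitzOnWith (by decide) (convex_closedBall _ _)
    (isCompact_closedBall _ _)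
  exact hK.comp_absolutelyContinuousOnInterval hy fun t ht => by simpa using hR t ht

theorem mainTheorem1 {V : Type*} [Fintype V] [DecidableEq V]
    (𝒢 : SimpleGraph V) [DecidableRel 𝒢.Adj] (h𝒢 : 𝒢.Connected)
    (k N : ℕ) (hN : 0 < N)
    (f : EuclideanSpace ℝ (Fin N) → EuclideanSpace ℝ (Fin N)) (lf : ℝ≥0) (hf : LipschitzWith lf f)
    (A G : Matrix (Fin N) (Fin N) ℝ) (hG : G.PosDef)
    (ω θ : V → ℝ)
    (u : ℝ × NetState 𝒢 k N → Stack N V)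
    (uhat : ℝ × NetState 𝒢 k N → (i : V) → Stack N (kHop 𝒢 k i))
    (hu : Measurable u) (hu' : IsLocallyBounded u)
    (huhat : Measurable uhat) (huhat' : IsLocallyBounded uhat)
    (Y : ℝ → NetState 𝒢 k N)
    (hY : IsFilippovSolution (networkField 𝒢 k N f A G ω θ u uhat) Y)
    (i : V) (hi : (kHop 𝒢 k i).Nonempty)
    (κ : ℝ≥0∞)
    (hκ : κ = filippovNorm (fun p => estError 𝒢 k N i (u p, uhat p))
      ((fun t => (t, Y t)) '' Set.Ioi 0))
    (d : ℝ≥0) (hd : κ ≤ d)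
    (hθ : θ i > lamMax (Mkc 𝒢 k i) * lamMax G / (lamMin (Mkc 𝒢 k i) * lamMin G) * d)
    (hω : ω i ≥ 1 / lamMin (Mkc 𝒢 k i) *
      (1 + lf * specNorm (Mkc 𝒢 k i ⊗ₖ G) / (lamMin (Mkc 𝒢 k i) * lamMin (Gᵀ * G))))
    (hGA : (-(Gᵀ * A + Aᵀ * G - (2 : ℝ) • (Gᵀ * G))).PosDef) :
    0 < phi 𝒢 k N G θ i κ.toReal ∧
    ∃ T : ℝ, 0 ≤ T ∧ (estError 𝒢 k N i (Y 0) ≠ 0 → 0 < T) ∧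
      T ≤ lamMax (Mkc 𝒢 k i) * lamMax G / phi 𝒢 k N G θ i κ.toReal
          * ‖estError 𝒢 k N i (Y 0)‖ ∧
      ∀ t : ℝ, T ≤ t → estError 𝒢 k N i (Y t) = 0 := by
  have : Nonempty (kHop 𝒢 k i) := hi.to_subtype
  have : Nonempty (Fin N) := ⟨⟨0, hN⟩⟩
  have hM := posDef_Mkc 𝒢 k h𝒢 i
  have hκtop : κ ≠ ∞ := (hd.trans_lt ENNReal.coe_lt_top).ne
  have hκd : κ.toReal ≤ d := by simpa using ENNReal.toReal_mono ENNReal.coe_ne_top hd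
  have hκ0 : 0 ≤ κ.toReal := ENNReal.toReal_nonneg
  have hφ : 0 < phi 𝒢 k N G θ i κ.toReal := phi_expression_pos hM hG hκ0 hκd hθ
  have hθ0 : 0 ≤ θ i := by
    have h1 := hM.lamMin_pos
    have h2 := hG.lamMin_pos
    have h3 := hM.lamMax_pos
    have h4 := hG.lamMax_pos
    exact (by positivity :
      0 ≤ lamMax (Mkc 𝒢 k i) * lamMax G / (lamMin (Mkc 𝒢 k i) * lamMin G) * d).trans hθ.le
  set φ := phi 𝒢 k N G θ i κ.toReal
  have hΛ : 0 < lamMax (Mkc 𝒢 k i) * lamMax G := mul_pos hM.lamMax_pos hG.lamMax_pos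
  set Λ := lamMax (Mkc 𝒢 k i) * lamMax G
  set e : ℝ → Stack N (kHop 𝒢 k i) := fun t => estError 𝒢 k N i (Y t)
  let B := Matrix.toEuclideanCLM (n := kHop 𝒢 k i × Fin N) (𝕜 := ℝ) (Mkc 𝒢 k i ⊗ₖ G)
  let W : ℝ → ℝ := fun t => inner ℝ (e t) (B (e t))
  have hMG := hM.kronecker hG
  have hinner : ∀ x y, inner ℝ x (B y) = x.ofLp ⬝ᵥ (Mkc 𝒢 k i ⊗ₖ G) *ᵥ y.ofLp := fun x y => by
    rw [Matrix.inner_toEuclideanCLM]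
  have hsymm : ∀ x y, inner ℝ x (B y) = inner ℝ (B x) y := fun x y => by
    rw [real_inner_comm y (B x), hinner, hinner, ← hMG.mulVec_dotProduct_comm, dotProduct_comm]
  have hW0 : ∀ t, 0 ≤ W t := fun t => by
    simp only [W, hinner]
    exact hMG.posSemidef.dotProduct_mulVec_self_nonneg _
  have hWle : ∀ t, √(W t) ≤ √Λ * ‖e t‖ := fun t => by
    rw [← Real.sqrt_sq (norm_nonneg (e t)), ← Real.sqrt_mul hΛ.le]
    refine Real.sqrt_le_sqrt ?_
    rw [euclideanSpace_norm_sq_eq_dotProduct]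
    simp only [W, hinner]
    exact dotProduct_mulVec_kronecker_le hM hG _
  have hsΛ : 0 < √Λ := Real.sqrt_pos.2 hΛ
  -- The settling time is chosen equal to its upper bound, which is positive as soon as `e 0 ≠ 0`.
  refine ⟨hφ, Λ / φ * ‖e 0‖, by positivity, fun hne => ?_, le_rfl, fun t ht => ?_⟩
  · have : 0 < ‖e 0‖ := norm_pos_iff.2 hne
    positivity
  have ht0 : 0 ≤ t := (by positivity : 0 ≤ Λ / φ * ‖e 0‖).trans ht
  have hac : AbsolutelyContinuousOnInterval W 0 t :=
    AbsolutelyContinuousOnInterval.inner_clm_self B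
      ((estErrorCLM 𝒢 k N i).lipschitz.lipschitzOnWith
        |>.comp_absolutelyContinuousOnInterval (s := univ) (hY.1 t ht0) fun _ _ => mem_univ _)
  have hderiv : ∀ᵐ s : ℝ, 0 < s →
      ∃ v, HasDerivAt W v s ∧ v ≤ -(2 * (φ / √Λ) * √(W s)) := by
    filter_upwards [hY.2] with s hs hs0
    obtain ⟨v, hv, hYv⟩ := hs hs0
    have hev : HasDerivAt e (estError 𝒢 k N i v) s :=
      (estErrorCLM 𝒢 k N i).hasFDerivAt.comp_hasDerivAt s hYv
    have hBev : HasDerivAt (fun t => B (e t)) (B (estError 𝒢 k N i v)) s :=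
      B.hasFDerivAt.comp_hasDerivAt s hev
    refine ⟨_, hev.inner ℝ hBev, ?_⟩
    have hle := weightedError_dotProduct_le 𝒢 k N h𝒢 hN hf hG hu' huhat' hi hω hGA hθ0 hκ0
      (p := (s, Y s)) (fun z hz => by
        rw [hκ]
        exact norm_le_toReal_filippovNorm (hκ ▸ hκtop) (mem_image_of_mem _ hs0) hz) hv
    have hle' : inner ℝ (B (e s)) (estError 𝒢 k N i v) ≤ -(φ * ‖e s‖) := hle
    -- By symmetry of `B` both halves of the product rule equal `⟨B e, ė⟩`, which gives the factor
    -- 2.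
    rw [hsymm (e s), real_inner_comm (B (e s)) (estError 𝒢 k N i v)]
    have h1 : φ / √Λ * √(W s) ≤ φ * ‖e s‖ := by
      rw [div_mul_eq_mul_div, div_le_iff₀ hsΛ]
      have := mul_le_mul_of_nonneg_left (hWle s) hφ.le
      linarith
    linarith
  have hWt : W t = 0 := by
    refine eq_zero_of_ae_deriv_le_neg_sqrt (c := φ / √Λ) (by positivity) hW0 hac hderiv ?_
    refine le_trans ?_ ht
    rw [div_div_eq_mul_div, div_mul_eq_mul_div]
    refine div_le_div_of_nonneg_right ?_ hφ.le
    calc √(W 0) * √Λ ≤ (√Λ * ‖e 0‖) * √Λ := by gcongr; exact hWle 0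
      _ = Λ * ‖e 0‖ := by rw [mul_right_comm, Real.mul_self_sqrt hΛ.le]
  -- `W t = 0` forces `e t = 0` because `M ⊗ G` is positive definite.
  by_contra hne
  have hne' : (e t).ofLp ≠ 0 := fun h => hne (WithLp.ofLp_injective 2 h)
  have hpos := hMG.dotProduct_mulVec_pos hne'
  rw [star_trivial, ← hinner] at hpos
  exact hpos.ne' hWt
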